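/- Let $T,J\in\mathbb N$, let $\Omega$ be a non-empty subset of $(\mathbb R_{++}\times\mathbb R^J)^T$ (where $\mathbb R_{++}=(0,\infty)$) with the Euclidean metric, and let $Z:\Omega\to[1,\infty)$ be a continuous function whose sublevel sets $\{\omega\in\Omega: Z(\omega)\le z\}$, $z\in\mathbb R_+$, are all compact. Let $B$ be the space of Borel measurable functions $X:\Omega\to\mathbb R$, and $B^+=\{X\in B: X\ge 0\}$. Let $B_Z$ be the set of all $X\in B$ such that $X/Z$ is bounded, and let $U_Z$ and $C_Z$ be the sets of upper semicontinuous and of continuous elements of $B_Z$, respectively. Let $\mathcal P_Z$ be the set of Borel probability measures $\mathbb P$ on $\Omega$ with $\mathbb E^{\mathbb P}Z<\infty$. Let $G\subseteq B$ with $0\in G$, and let $A\subseteq B$ be such that $B^+\subseteq A$, $A+B^+\subseteq A$ and $A-G$ is convex. Define $$\phi(X)=\inf\{m\in\mathbb R: m-X\in A-G\}\quad(\inf\emptyset=+\infty),\qquad \phi^*(\mathbb P)=\sup_{X\in C_Z}\bigl(\mathbb E^{\mathbb P}X-\phi(X)\bigr),\quad \mathbb P\in\mathcal P_Z .$$ Assume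 that $$\text{for every integer } n\ge 1 \text{ there exists } z\in\mathbb R_+ \text{ such that } n(Z-z)^+-\tfrac1n\in G-A. \tag{1}$$ Then the following three conditions are equivalent: (i) there exist no $X\in G-A$ and $\varepsilon>0$ such that $X\ge\varepsilon$; (ii) there exists $\mathbb P\in\mathcal P_Z$ such that $\mathbb E^{\mathbb P}X\le 0$ for all $X\in C_Z\cap(G-A)$; (iii) $\phi$ is real-valued on $B_Z$, $\phi(0)=0$, and $\phi(X)=\max_{\mathbb P\in\mathcal P_Z}\bigl(\mathbb E^{\mathbb P}X-\phi^*(\mathbb P)\bigr)$ for all $X\in C_Z$ (the maximum being attained). If, in addition to (1), $$\phi(X)=\inf_{Y\in C_Z,\,Y\ge X}\phi(Y)\quad\text{for all } X\in U_Z, \tag{2}$$ then (i)–(iii) are also equivalent to each of the following three conditions: (iv) there exists no $X\in G-A$ such that $X(\omega)>0$ for all $\omega\in\Omega$; (v) there exists $\mathbb P\in\mathcal P_Z$ such that $\mathbb E^{\mathbb P}X\le 0$ for all $X\in U_Z\cap(G-A)$; (vi) $\phi$ is real-valued on $B_Z$, $\phi(0)=0$, and $\phi(X)=\max_{\mathbb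 P\in\mathcal P_Z}\bigl(\mathbb E^{\mathbb P}X-\phi^*(\mathbb P)\bigr)$ for all $X\in U_Z$ (the maximum being attained). -/

import Mathlib

open MeasureTheory
open scoped Pointwise

noncomputable section

namespace RobustHedging

/-- The ambient path space `(ℝ × ℝ^J)^T` with the Euclidean metric. The coordinate `ω (t, j)` is the
price at time `t + 1` of asset `j`; asset `0` is the numeraire. -/
abbrev PathSpace (T J : ℕ) : Type := EuclideanSpace ℝ (Fin T × Fin (J + 1))

/-- The set `(ℝ₊₊ × ℝ^J)^T` of all paths along which the numeraire is strictly positive. -/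
def positivePaths (T J : ℕ) : Set (PathSpace T J) := {ω | ∀ t : Fin T, 0 < ω (t, 0)}

/-- The space `B` of all Borel measurable real functions. -/
def B (Ω : Type*) [MeasurableSpace Ω] : Set (Ω → ℝ) := {X | Measurable X}

/-- The cone `B⁺` of non-negative Borel measurable functions. -/
def BPlus (Ω : Type*) [MeasurableSpace Ω] : Set (Ω → ℝ) := {X | X ∈ B Ω ∧ ∀ ω, 0 ≤ X ω}

/-- `B_Z`: the measurable functions `X` such that `X / Z` is bounded. -/
def BZ {Ω : Type*} [MeasurableSpace Ω] (Z : Ω → ℝ) : Set (Ω → ℝ) :=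
  {X | X ∈ B Ω ∧ ∃ c : ℝ, ∀ ω, |X ω / Z ω| ≤ c}

/-- `U_Z`: the upper semicontinuous elements of `B_Z`. -/
def UZ {Ω : Type*} [TopologicalSpace Ω] [MeasurableSpace Ω] (Z : Ω → ℝ) : Set (Ω → ℝ) :=
  {X | X ∈ BZ Z ∧ UpperSemicontinuous X}

/-- `C_Z`: the continuous elements of `B_Z`. -/
def CZ {Ω : Type*} [TopologicalSpace Ω] [MeasurableSpace Ω] (Z : Ω → ℝ) : Set (Ω → ℝ) :=
  {X | X ∈ BZ Z ∧ Continuous X}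

/-- `𝒫_Z`: the Borel probability measures that integrate `Z`. -/
def PZ {Ω : Type*} [MeasurableSpace Ω] (Z : Ω → ℝ) : Set (Measure Ω) :=
  {P | IsProbabilityMeasure P ∧ Integrable Z P}

/-- The superhedging functional `φ(X) = inf {m ∈ ℝ : m - X ∈ A - G}`, with `inf ∅ = +∞`. -/
def phi {Ω : Type*} (G A : Set (Ω → ℝ)) (X : Ω → ℝ) : EReal :=
  sInf ((fun m : ℝ => (m : EReal)) '' {m : ℝ | (fun ω => m - X ω) ∈ A - G})

/-- The convex conjugate `φ*(P) = sup_{X ∈ C_Z} (E^P X - φ(X))`. Elements of `C_Z` are integrable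
under every `P ∈ 𝒫_Z`, and a real number minus an extended real is never of the form `∞ - ∞`. -/
def phiStar {Ω : Type*} [TopologicalSpace Ω] [MeasurableSpace Ω] (Z : Ω → ℝ) (G A : Set (Ω → ℝ))
    (P : Measure Ω) : EReal :=
  ⨆ X ∈ CZ Z, (((∫ ω, X ω ∂P : ℝ) : EReal) - phi G A X)

/-- For every `n ≥ 1` some `n (Z - z)⁺ - 1/n` with `z ≥ 0` belongs to `G - A`. -/
def CallCondition {Ω : Type*} (Z : Ω → ℝ) (G A : Set (Ω → ℝ)) : Prop :=
  ∀ n : ℕ, 0 < n → ∃ z : ℝ, 0 ≤ z ∧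
    (fun ω => (n : ℝ) * max (Z ω - z) 0 - 1 / (n : ℝ)) ∈ G - A

/-- `φ(X) = inf_{Y ∈ C_Z, Y ≥ X} φ(Y)` for all `X ∈ U_Z`. -/
def UscCondition {Ω : Type*} [TopologicalSpace Ω] [MeasurableSpace Ω] (Z : Ω → ℝ)
    (G A : Set (Ω → ℝ)) : Prop :=
  ∀ X ∈ UZ Z, phi G A X = sInf (phi G A '' {Y | Y ∈ CZ Z ∧ ∀ ω, X ω ≤ Y ω})

/-- No uniform arbitrage: no `X ∈ G - A` satisfies `X ≥ ε` for some `ε > 0`. -/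
def NoUniformArbitrage {Ω : Type*} (G A : Set (Ω → ℝ)) : Prop :=
  ¬ ∃ X ∈ G - A, ∃ ε : ℝ, 0 < ε ∧ ∀ ω, ε ≤ X ω

/-- No pointwise arbitrage: no `X ∈ G - A` is strictly positive everywhere. -/
def NoPointwiseArbitrage {Ω : Type*} (G A : Set (Ω → ℝ)) : Prop :=
  ¬ ∃ X ∈ G - A, ∀ ω, 0 < X ω

/-- Some `P ∈ 𝒫_Z` satisfies `E^P X ≤ 0` for all `X ∈ D ∩ (G - A)`. -/
def HasPricingMeasure {Ω : Type*} [MeasurableSpace Ω] (Z : Ω → ℝ) (G A D : Set (Ω → ℝ)) : Prop :=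
  ∃ P ∈ PZ Z, ∀ X ∈ D ∩ (G - A), ∫ ω, X ω ∂P ≤ 0

/-- `φ` is real-valued on `B_Z`, `φ(0) = 0`, and `φ(X) = max_{P ∈ 𝒫_Z} (E^P X - φ*(P))`, with the
maximum attained, for all `X ∈ D`. -/
def HasDualFormula {Ω : Type*} [TopologicalSpace Ω] [MeasurableSpace Ω] (Z : Ω → ℝ)
    (G A D : Set (Ω → ℝ)) : Prop :=
  (∀ X ∈ BZ Z, ∃ r : ℝ, phi G A X = (r : EReal)) ∧
  phi G A 0 = 0 ∧
  ∀ X ∈ D, IsGreatest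
    ((fun P : Measure Ω => ((∫ ω, X ω ∂P : ℝ) : EReal) - phiStar Z G A P) '' PZ Z) (phi G A X)

end RobustHedging

end

/-! The set `A - G` is convex, upward closed and contains `0`, so `φ` is convex and monotone with
`φ(X + c) ≤ φ(X) + c`, and (i) says exactly that `φ(0) = 0`. The call condition then makes `φ`
finite on `B_Z`.

For `X ∈ B_Z`, Hahn–Banach gives a linear subgradient on `C_Z` of `W ↦ φ(X + W)` at `0`.
Monotonicity makes it positive, translation by constants normalises it, and the call condition makes
it small on `(Z - z)⁺`. This tightness forbids mass from escaping the compact sublevel sets of `Z`,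
so the Riesz–Markov theorem turns the subgradient into a measure in `𝒫_Z`
(`exists_measure_integral_le`).

For `X ∈ U_Z` this measure attains the dual formula, since expectations of `X` are approximated from
above by continuous functions; (2) is needed only for the reverse inequality. The dual formula at
`0` gives a pricing measure, which excludes arbitrage: a constant serves as test function in the
uniform case, a multiple of the indicator of a closed set in the pointwise case. -/

open Filter Topology Set
open scoped CompactlySupported

/-! ### Convex subgradients and semicontinuous approximation. -/

/-- A finite convex function on a real vector space has a (linear) subgradient at `0`. -/
theorem ConvexOn.exists_subgradient_zero {E : Type*} [AddCommGroup E] [Module ℝ E] {f : E → ℝ}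
    (hf : ConvexOn ℝ univ f) : ∃ l : E →ₗ[ℝ] ℝ, ∀ y, l y ≤ f y - f 0 := by
  -- `0` is the convex combination of `t • y` and `-y` with weights `1/(1+t)` and `t/(1+t)`; this
  -- bounds the difference quotients from below.
  have hlow : ∀ y, ∀ t : Ioi (0 : ℝ), f 0 - f (-y) ≤ (f ((t : ℝ) • y) - f 0) / t := by
    rintro y ⟨t, ht⟩
    have ht : 0 < t := ht
    have h := hf.2 (mem_univ (t • y)) (mem_univ (-y))
      (by positivity : 0 ≤ 1 / (1 + t)) (by positivity : 0 ≤ t / (1 + t)) (by field_simp)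
    have h0 : (1 / (1 + t)) • t • y + (t / (1 + t)) • -y = 0 := by
      rw [smul_smul, smul_neg, ← sub_eq_add_neg, ← sub_smul]
      rw [one_div_mul_eq_div, sub_self, zero_smul]
    rw [h0, smul_eq_mul, smul_eq_mul, div_mul_eq_mul_div, div_mul_eq_mul_div, ← add_div,
      le_div_iff₀ (by positivity)] at h
    rw [le_div_iff₀ ht]
    linarith
  have hbdd : ∀ y, BddBelow (range fun t : Ioi (0 : ℝ) => (f ((t : ℝ) • y) - f 0) / t) := by
    intro y
    refine ⟨f 0 - f (-y), ?_⟩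
    rintro _ ⟨t, rfl⟩
    exact hlow y t
  have : Nonempty (Ioi (0 : ℝ)) := ⟨⟨1, mem_Ioi.2 one_pos⟩⟩
  -- `N` is the one-sided directional derivative of `f` at `0`, the sublinear bound for Hahn–Banach.
  set N : E → ℝ := fun y => ⨅ t : Ioi (0 : ℝ), (f ((t : ℝ) • y) - f 0) / t with hN
  have hle : ∀ y, ∀ t : ℝ, 0 < t → N y ≤ (f (t • y) - f 0) / t :=
    fun y t ht => ciInf_le (hbdd y) ⟨t, ht⟩
  have hscale : ∀ c : ℝ, 0 < c → ∀ x, N (c • x) ≤ c * N x := by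
    intro c hc x
    rw [← div_le_iff₀' hc]
    refine le_ciInf ?_
    rintro ⟨t, ht⟩
    have ht : 0 < t := ht
    have h := hle (c • x) (t / c) (by positivity)
    rw [smul_smul, div_mul_cancel₀ _ hc.ne'] at h
    rw [div_le_iff₀ hc]
    calc N (c • x) ≤ _ := h
      _ = _ := by simp; field_simp
  have hhom : ∀ c : ℝ, 0 < c → ∀ x, N (c • x) = c * N x := by
    intro c hc x
    refine le_antisymm (hscale c hc x) ?_
    have h := hscale c⁻¹ (by positivity) (c • x)
    rw [smul_smul, inv_mul_cancel₀ hc.ne', one_smul] at h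
    rwa [← le_inv_mul_iff₀ hc]
  have hadd : ∀ x y, N (x + y) ≤ N x + N y := by
    intro x y
    -- Independent step sizes `t` and `s` let the two infima be taken one after the other, without
    -- monotonicity of the difference quotients.
    have key : ∀ t s : ℝ, 0 < t → 0 < s →
        N (x + y) ≤ (f (t • x) - f 0) / t + (f (s • y) - f 0) / s := by
      intro t s ht hs
      have h1 := hle (x + y) (t * s / (t + s)) (by positivity)
      have h := hf.2 (mem_univ (t • x)) (mem_univ (s • y))
        (by positivity : 0 ≤ s / (t + s)) (by positivity : 0 ≤ t / (t + s)) (by field_simp; ring)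
      have h0 : (s / (t + s)) • t • x + (t / (t + s)) • s • y = (t * s / (t + s)) • (x + y) := by
        rw [smul_smul, smul_smul, smul_add]
        congr 2 <;> ring
      rw [h0, smul_eq_mul, smul_eq_mul] at h
      refine h1.trans ?_
      rw [div_le_iff₀ (by positivity)]
      have e : ((f (t • x) - f 0) / t + (f (s • y) - f 0) / s) * (t * s / (t + s))
          = s / (t + s) * f (t • x) + t / (t + s) * f (s • y) - f 0 := by
        field_simp
        ring
      rw [e]
      linarith
    have h2 : ∀ s : ℝ, 0 < s → N (x + y) - (f (s • y) - f 0) / s ≤ N x := by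
      intro s hs
      refine le_ciInf ?_
      rintro ⟨t, ht⟩
      have := key t s ht hs
      simp only
      linarith
    have h3 : N (x + y) - N x ≤ N y := by
      refine le_ciInf ?_
      rintro ⟨s, hs⟩
      have := h2 s hs
      simp only
      linarith
    linarith
  obtain ⟨g, -, hg⟩ := exists_extension_of_le_sublinear (⊥ : E →ₗ.[ℝ] ℝ) N hhom hadd (by
    rintro ⟨x, hx⟩
    have hx0 : x = 0 := (Submodule.mem_bot ℝ).1 hx
    subst hx0
    have : N 0 = 0 := by simp [hN]
    have h2 : (⊥ : E →ₗ.[ℝ] ℝ) ⟨0, hx⟩ = 0 := map_zero (⊥ : E →ₗ.[ℝ] ℝ).toFun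
    rw [h2]; exact this.ge)
  refine ⟨g, fun y => (hg y).trans ?_⟩
  simpa using hle y 1 one_pos

/-- A bounded upper semicontinuous function on a metric space is the pointwise limit of continuous
functions which lie above it and satisfy the same bound. -/
theorem UpperSemicontinuous.exists_continuous_tendsto {α : Type*} [PseudoMetricSpace α]
    {g : α → ℝ} (hg : UpperSemicontinuous g) {c : ℝ} (hc : ∀ x, |g x| ≤ c) :
    ∃ Y : ℕ → α → ℝ, (∀ n, Continuous (Y n)) ∧ (∀ n x, g x ≤ Y n x) ∧ (∀ n x, |Y n x| ≤ c) ∧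
      ∀ x, Tendsto (fun n => Y n x) atTop (𝓝 (g x)) := by
  have hub : ∀ (n : ℕ) (x y : α), g y - n * dist x y ≤ c := by
    intro n x y
    have h1 : (0 : ℝ) ≤ n * dist x y := by positivity
    have := (abs_le.1 (hc y)).2
    linarith
  have hbdd : ∀ (n : ℕ) (x : α), BddAbove (range fun y => g y - n * dist x y) := by
    intro n x
    refine ⟨c, ?_⟩
    rintro _ ⟨y, rfl⟩
    exact hub n x y
  -- The sup-convolution with `n * dist` is the least `n`-Lipschitz majorant of `g`.
  set Y : ℕ → α → ℝ := fun n x => ⨆ y, (g y - n * dist x y) with hY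
  have hge : ∀ n x, g x ≤ Y n x := by
    intro n x
    have := le_ciSup (hbdd n x) x
    simpa using this
  have hleY : ∀ (n : ℕ) (x : α) (b : ℝ), (∀ y, g y - n * dist x y ≤ b) → Y n x ≤ b := by
    intro n x b h
    have : Nonempty α := ⟨x⟩
    exact ciSup_le h
  have habs : ∀ n x, |Y n x| ≤ c := by
    intro n x
    rw [abs_le]
    exact ⟨(abs_le.1 (hc x)).1.trans (hge n x), hleY n x c (hub n x)⟩
  refine ⟨Y, ?_, hge, habs, ?_⟩
  · intro n
    have : LipschitzWith (n : NNReal) (Y n) := by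
      refine LipschitzWith.of_le_add_mul _ fun x x' => hleY _ _ _ fun y => ?_
      have h1 := le_ciSup (hbdd n x') y
      have h2 : dist x' y ≤ dist x x' + dist x y := by
        rw [dist_comm x x']; exact dist_triangle _ _ _
      have h3 : (n : ℝ) * dist x' y ≤ n * (dist x x' + dist x y) := by gcongr
      have h4 : g y - n * dist x' y ≤ Y n x' := h1
      push_cast
      linarith
    exact this.continuous
  · intro x
    rw [Metric.tendsto_atTop]
    intro ε hε
    obtain ⟨δ, hδ, hball⟩ := Metric.eventually_nhds_iff.1 (hg x (g x + ε / 2) (by linarith))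
    -- Beyond distance `δ` the penalty `n * dist` is at least `2c`, the largest possible oscillation
    -- of `g`, so only points of the ball matter.
    obtain ⟨M, hM⟩ := exists_nat_ge (2 * c / δ)
    refine ⟨M, fun n hn => ?_⟩
    have hle : Y n x ≤ g x + ε / 2 := by
      refine hleY _ _ _ fun y => ?_
      by_cases hy : dist y x < δ
      · have := hball hy
        have h1 : (0 : ℝ) ≤ n * dist x y := by positivity
        linarith
      · push Not at hy
        rw [dist_comm] at hy
        have h1 : (M : ℝ) * δ ≤ n * dist x y := by gcongr
        have h2 : 2 * c ≤ M * δ := (div_le_iff₀ hδ).1 hM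
        have h3 := (abs_le.1 (hc x)).1
        have h4 := (abs_le.1 (hc y)).2
        linarith
    rw [Real.dist_eq, abs_lt]
    have := hge n x
    constructor <;> linarith

namespace RobustHedging

/-! ### Weighted function spaces and the Riesz representation on `C_Z`. -/

section WeightedSpaces

variable {Ω : Type*} [MeasurableSpace Ω] {Z : Ω → ℝ}

theorem mem_BZ_iff (hZ : ∀ ω, 1 ≤ Z ω) {X : Ω → ℝ} :
    X ∈ BZ Z ↔ Measurable X ∧ ∃ c : ℝ, 0 ≤ c ∧ ∀ ω, |X ω| ≤ c * Z ω := by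
  have hpos : ∀ ω, 0 < Z ω := fun ω => one_pos.trans_le (hZ ω)
  have key : ∀ c ω, |X ω / Z ω| ≤ c ↔ |X ω| ≤ c * Z ω := by
    intro c ω
    rw [abs_div, abs_of_pos (hpos ω), div_le_iff₀ (hpos ω)]
  constructor
  · rintro ⟨hX, c, hc⟩
    refine ⟨hX, max c 0, le_max_right _ _, fun ω => ?_⟩
    exact ((key c ω).1 (hc ω)).trans
      (mul_le_mul_of_nonneg_right (le_max_left _ _) (hpos ω).le)
  · rintro ⟨hX, c, -, hc⟩
    exact ⟨hX, c, fun ω => (key c ω).2 (hc ω)⟩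

/-- `B_Z` as a linear subspace of the space of all functions. -/
def weightedMeasurable (Z : Ω → ℝ) (hZ : ∀ ω, 1 ≤ Z ω) : Submodule ℝ (Ω → ℝ) where
  carrier := BZ Z
  zero_mem' := (mem_BZ_iff hZ).2 ⟨measurable_const, 0, le_rfl, by simp⟩
  add_mem' := by
    intro X Y hX hY
    obtain ⟨hXm, c, hc, hXc⟩ := (mem_BZ_iff hZ).1 hX
    obtain ⟨hYm, d, hd, hYd⟩ := (mem_BZ_iff hZ).1 hY
    refine (mem_BZ_iff hZ).2 ⟨hXm.add hYm, c + d, by positivity, fun ω => ?_⟩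
    rw [add_mul]
    exact (abs_add_le _ _).trans (add_le_add (hXc ω) (hYd ω))
  smul_mem' := by
    intro a X hX
    obtain ⟨hXm, c, hc, hXc⟩ := (mem_BZ_iff hZ).1 hX
    refine (mem_BZ_iff hZ).2 ⟨hXm.const_smul a, |a| * c, by positivity, fun ω => ?_⟩
    rw [Pi.smul_apply, smul_eq_mul, abs_mul, mul_assoc]
    exact mul_le_mul_of_nonneg_left (hXc ω) (abs_nonneg a)

theorem integrable_of_mem_BZ (hZ : ∀ ω, 1 ≤ Z ω) {X : Ω → ℝ} (hX : X ∈ BZ Z) {P : Measure Ω}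
    (hP : Integrable Z P) : Integrable X P := by
  obtain ⟨hXm, c, -, hc⟩ := (mem_BZ_iff hZ).1 hX
  exact (hP.const_mul c).mono' hXm.aestronglyMeasurable (ae_of_all _ hc)

variable [TopologicalSpace Ω]

theorem CZ_subset_UZ : CZ Z ⊆ UZ Z := fun _ h => ⟨h.1, h.2.upperSemicontinuous⟩

/-- `C_Z` as a linear subspace of the space of all functions. -/
def weightedContinuous (Z : Ω → ℝ) (hZ : ∀ ω, 1 ≤ Z ω) : Submodule ℝ (Ω → ℝ) where
  carrier := CZ Z
  zero_mem' := ⟨(weightedMeasurable Z hZ).zero_mem, continuous_const⟩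
  add_mem' hX hY := ⟨(weightedMeasurable Z hZ).add_mem hX.1 hY.1, hX.2.add hY.2⟩
  smul_mem' a _ hX := ⟨(weightedMeasurable Z hZ).smul_mem a hX.1, hX.2.const_smul a⟩

variable [BorelSpace Ω]

theorem mem_CZ_of_abs_le (hZ : ∀ ω, 1 ≤ Z ω) {X : Ω → ℝ} (hX : Continuous X) {c : ℝ}
    (hc : ∀ ω, |X ω| ≤ c * Z ω) : X ∈ CZ Z :=
  ⟨⟨hX.measurable, c, fun ω => by
    have := one_pos.trans_le (hZ ω)
    rw [abs_div, abs_of_pos this, div_le_iff₀ this]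
    exact hc ω⟩, hX⟩

theorem const_mem_CZ (hZ : ∀ ω, 1 ≤ Z ω) (a : ℝ) : (fun _ : Ω => a) ∈ CZ Z :=
  mem_CZ_of_abs_le hZ continuous_const (c := |a|) fun ω =>
    le_mul_of_one_le_right (abs_nonneg a) (hZ ω)

theorem weight_mem_CZ (hZ : ∀ ω, 1 ≤ Z ω) (hZc : Continuous Z) : Z ∈ CZ Z :=
  mem_CZ_of_abs_le hZ hZc (c := 1) fun ω => by
    rw [one_mul, abs_of_nonneg (zero_le_one.trans (hZ ω))]

theorem call_mem_CZ (hZ : ∀ ω, 1 ≤ Z ω) (hZc : Continuous Z) {z : ℝ} (hz : 0 ≤ z) :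
    (fun ω => max (Z ω - z) 0) ∈ CZ Z :=
  mem_CZ_of_abs_le hZ (by fun_prop) (c := 1) fun ω => by
    have := hZ ω
    rw [one_mul, abs_of_nonneg (le_max_right _ _)]
    exact max_le (by linarith) (by linarith)

/-- A positive normalised linear functional on `C_Z` that is small on the functions `(Z - z)⁺` with
`z` large is the integral with respect to a probability measure that integrates `Z`. -/
theorem exists_measure_integral_eq [T2Space Ω] (hZ : ∀ ω, 1 ≤ Z ω) (hZc : Continuous Z)
    (hcomp : ∀ z : ℝ, 0 ≤ z → IsCompact {ω : Ω | Z ω ≤ z})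
    (l : weightedContinuous Z hZ →ₗ[ℝ] ℝ)
    (hpos : ∀ W : weightedContinuous Z hZ, (∀ ω, 0 ≤ W.1 ω) → 0 ≤ l W)
    (hone : l ⟨fun _ => 1, const_mem_CZ hZ 1⟩ = 1)
    (htight : ∀ ε : ℝ, 0 < ε → ∃ (z : ℝ) (hz : 0 ≤ z),
      l ⟨fun ω => max (Z ω - z) 0, call_mem_CZ hZ hZc hz⟩ ≤ ε) :
    ∃ P ∈ PZ Z, ∀ W : weightedContinuous Z hZ, ∫ ω, W.1 ω ∂P = l W := by
  have hmono : ∀ V W : weightedContinuous Z hZ, (∀ ω, V.1 ω ≤ W.1 ω) → l V ≤ l W := by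
    intro V W h
    have := hpos (W - V) fun ω => sub_nonneg.2 (h ω)
    rw [map_sub] at this
    linarith
  have : WeaklyLocallyCompactSpace Ω := by
    refine ⟨fun x => ⟨{ω | Z ω ≤ Z x + 1}, hcomp _ ?_, ?_⟩⟩
    · linarith [hZ x]
    · exact (hZc.tendsto x).eventually (Iic_mem_nhds (by linarith))
  have hcc : ∀ f : C_c(Ω, ℝ), (f : Ω → ℝ) ∈ CZ Z := by
    intro f
    obtain ⟨c, hc⟩ := f.hasCompactSupport.exists_bound_of_continuous f.continuous
    refine mem_CZ_of_abs_le hZ f.continuous (c := max c 0) fun ω => ?_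
    exact (hc ω).trans ((le_max_left _ _).trans
      (le_mul_of_one_le_right (le_max_right _ _) (hZ ω)))
  let Λ₀ : C_c(Ω, ℝ) →ₗ[ℝ] ℝ :=
    { toFun := fun f => l ⟨f, hcc f⟩
      map_add' := fun f g => l.map_add ⟨f, hcc f⟩ ⟨g, hcc g⟩
      map_smul' := fun a f => l.map_smul a ⟨f, hcc f⟩ }
  let Λ : C_c(Ω, ℝ) →ₚ[ℝ] ℝ := PositiveLinearMap.mk₀ Λ₀ fun f hf => hpos _ fun ω => hf ω
  set P : Measure Ω := RealRMK.rieszMeasure Λ with hP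
  have hint : ∀ f : C_c(Ω, ℝ), ∫ ω, f ω ∂P = l ⟨f, hcc f⟩ := RealRMK.integral_rieszMeasure Λ
  -- Cut-offs equal to `1` on `{Z ≤ k}` and vanishing off the compact set `{Z ≤ k + 1}`.
  let χ : ℕ → Ω → ℝ := fun k ω => max 0 (min 1 (k + 1 - Z ω))
  have hχc : ∀ k, Continuous (χ k) := fun k => by fun_prop
  have hχ0 : ∀ k ω, 0 ≤ χ k ω := fun k ω => le_max_left _ _
  have hχ1 : ∀ k ω, χ k ω ≤ 1 := fun k ω => max_le zero_le_one (min_le_left _ _)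
  have hχeq : ∀ (k : ℕ) ω, Z ω ≤ k → χ k ω = 1 := by
    intro k ω h
    have : min 1 ((k : ℝ) + 1 - Z ω) = 1 := min_eq_left (by linarith)
    simp only [χ, this]
    norm_num
  have hχsupp : ∀ k, HasCompactSupport (χ k) := by
    intro k
    refine HasCompactSupport.intro (hcomp (k + 1) (by positivity)) fun ω hω => ?_
    have hω : ¬ Z ω ≤ k + 1 := hω
    exact max_eq_left ((min_le_right _ _).trans (by linarith))
  have hχtend : ∀ ω, ∀ᶠ k : ℕ in atTop, χ k ω = 1 := by
    intro ω
    obtain ⟨M, hM⟩ := exists_nat_ge (Z ω)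
    filter_upwards [eventually_ge_atTop M] with k hk
    exact hχeq k ω (hM.trans (by exact_mod_cast hk))
  have hmemχ : ∀ (W : weightedContinuous Z hZ) k, (fun ω => W.1 ω * χ k ω) ∈ CZ Z := by
    intro W k
    obtain ⟨-, c, hc, hWc⟩ := (mem_BZ_iff hZ).1 W.2.1
    refine mem_CZ_of_abs_le hZ (W.2.2.mul (hχc k)) (c := c) fun ω => ?_
    rw [abs_mul, abs_of_nonneg (hχ0 k ω)]
    exact (mul_le_of_le_one_right (abs_nonneg _) (hχ1 k ω)).trans (hWc ω)
  have hintχ : ∀ (W : weightedContinuous Z hZ) k,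
      ∫ ω, W.1 ω * χ k ω ∂P = l ⟨_, hmemχ W k⟩ := fun W k =>
    hint ⟨⟨fun ω => W.1 ω * χ k ω, W.2.2.mul (hχc k)⟩, (hχsupp k).mul_left⟩
  have hlχ : ∀ W : weightedContinuous Z hZ,
      Tendsto (fun k => l ⟨_, hmemχ W k⟩) atTop (𝓝 (l W)) := by
    intro W
    obtain ⟨-, c, hc, hWc⟩ := (mem_BZ_iff hZ).1 W.2.1
    rw [Metric.tendsto_atTop]
    intro ε hε
    -- The `+ 1` keeps the denominator positive when `c = 0`.
    obtain ⟨z, hz, hlz⟩ := htight (ε / (2 * c + 1) / 2) (by positivity)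
    -- Where `Z > k ≥ 2z` one has `Z ≤ 2(Z - z)⁺`, so the error of the cut-off is at most `2c(Z -
    -- z)⁺`.
    obtain ⟨M, hM⟩ := exists_nat_ge (2 * z)
    refine ⟨M, fun k hk => ?_⟩
    set H : weightedContinuous Z hZ := ⟨fun ω => max (Z ω - z) 0, call_mem_CZ hZ hZc hz⟩ with hH
    set V : weightedContinuous Z hZ := ⟨_, hmemχ W k⟩ with hV
    have hbound : ∀ ω, |V.1 ω - W.1 ω| ≤ (2 * c) * H.1 ω := by
      intro ω
      have hH0 : 0 ≤ H.1 ω := le_max_right _ _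
      by_cases h : Z ω ≤ k
      · have : V.1 ω = W.1 ω := by simp only [hV, hχeq k ω h, mul_one]
        rw [this, sub_self, abs_zero]
        positivity
      · push Not at h
        have hk' : (M : ℝ) ≤ k := by exact_mod_cast hk
        have h1 : Z ω ≤ 2 * H.1 ω := by
          have : Z ω - z ≤ H.1 ω := le_max_left _ _
          linarith
        have h2 : |V.1 ω - W.1 ω| ≤ |W.1 ω| := by
          have : V.1 ω - W.1 ω = W.1 ω * (χ k ω - 1) := by simp only [hV]; ring
          rw [this, abs_mul]
          refine mul_le_of_le_one_right (abs_nonneg _) ?_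
          rw [abs_le]
          constructor <;> linarith [hχ0 k ω, hχ1 k ω]
        calc _ ≤ |W.1 ω| := h2
          _ ≤ c * Z ω := hWc ω
          _ ≤ c * (2 * H.1 ω) := by gcongr
          _ = _ := by ring
    have h1 : l (V - W) ≤ l ((2 * c) • H) := hmono _ _ fun ω => (abs_le.1 (hbound ω)).2
    have h2 : l (-((2 * c) • H)) ≤ l (V - W) := hmono _ _ fun ω => (abs_le.1 (hbound ω)).1
    rw [map_neg] at h2
    rw [map_sub, map_smul, smul_eq_mul] at *
    have hH0 : 0 ≤ l H := hpos H fun ω => le_max_right _ _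
    have h3 : 2 * c * l H < ε := by
      calc 2 * c * l H ≤ (2 * c + 1) * l H := by gcongr; linarith
        _ ≤ (2 * c + 1) * (ε / (2 * c + 1) / 2) := by gcongr
        _ = ε / 2 := by field_simp
        _ < ε := by linarith
    rw [Real.dist_eq, abs_lt]
    constructor <;> linarith
  -- Fatou's lemma: the integrals of `Z * χ k` are all bounded by `l Z`. Integrability of `Z` then
  -- supplies the dominating function for `hrep`.
  have hZint : Integrable Z P := by
    set W : weightedContinuous Z hZ := ⟨Z, weight_mem_CZ hZ hZc⟩ with hW
    have hnn : ∀ k ω, 0 ≤ Z ω * χ k ω := fun k ω =>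
      mul_nonneg (zero_le_one.trans (hZ ω)) (hχ0 k ω)
    have htend : ∀ ω, Tendsto (fun k => ‖Z ω * χ k ω‖ₑ) atTop (𝓝 ‖Z ω‖ₑ) := by
      refine fun ω => tendsto_const_nhds.congr' ?_
      filter_upwards [hχtend ω] with k hk
      rw [hk, mul_one]
    refine ⟨hZc.measurable.aestronglyMeasurable, ?_⟩
    refine ((lintegral_congr fun ω => (htend ω).liminf_eq.symm).trans_le
      (lintegral_liminf_le fun k => (hZc.mul (hχc k)).measurable.enorm)).trans_lt ?_
    refine lt_of_le_of_lt (b := ENNReal.ofReal (l W)) ?_ ENNReal.ofReal_lt_top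
    refine liminf_le_of_le (by isBoundedDefault) fun b hb => ?_
    obtain ⟨k, hk⟩ := hb.exists
    refine hk.trans ?_
    have hi : Integrable (fun ω => Z ω * χ k ω) P :=
      (hZc.mul (hχc k)).integrable_of_hasCompactSupport (hχsupp k).mul_left
    have e : ∫⁻ ω, ‖Z ω * χ k ω‖ₑ ∂P = ENNReal.ofReal (∫ ω, Z ω * χ k ω ∂P) := by
      rw [ofReal_integral_eq_lintegral_ofReal hi (ae_of_all _ (hnn k))]
      refine lintegral_congr fun ω => ?_
      rw [Real.enorm_eq_ofReal (hnn k ω)]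
    rw [e]
    refine ENNReal.ofReal_le_ofReal ?_
    rw [hintχ W k]
    exact hmono _ _ fun ω => mul_le_of_le_one_right (zero_le_one.trans (hZ ω)) (hχ1 k ω)
  have hrep : ∀ W : weightedContinuous Z hZ, ∫ ω, W.1 ω ∂P = l W := by
    intro W
    refine tendsto_nhds_unique (f := fun k => ∫ ω, W.1 ω * χ k ω ∂P) (l := atTop) ?_ ?_
    · refine tendsto_integral_of_dominated_convergence (fun ω => |W.1 ω|)
        (fun k => (W.2.2.mul (hχc k)).measurable.aestronglyMeasurable)
        (integrable_of_mem_BZ hZ W.2.1 hZint).abs (fun k => ae_of_all _ fun ω => ?_)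
        (ae_of_all _ fun ω => tendsto_const_nhds.congr' ?_)
      · rw [Real.norm_eq_abs, abs_mul, abs_of_nonneg (hχ0 k ω)]
        exact mul_le_of_le_one_right (abs_nonneg _) (hχ1 k ω)
      · filter_upwards [hχtend ω] with k hk
        rw [hk, mul_one]
    · simpa only [hintχ W] using hlχ W
  refine ⟨P, ⟨?_, hZint⟩, hrep⟩
  have h1 := (hrep ⟨fun _ => 1, const_mem_CZ hZ 1⟩).trans hone
  simp only [integral_const, smul_eq_mul, mul_one] at h1
  rw [measureReal_def] at h1
  exact ⟨(ENNReal.toReal_eq_one_iff _).1 h1⟩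

end WeightedSpaces

/-! ### The superhedging functional: monotonicity, convexity, finiteness, subgradients. -/

theorem mem_sub_comm_iff_neg_mem {Ω : Type*} {G A : Set (Ω → ℝ)} {X : Ω → ℝ} :
    X ∈ G - A ↔ -X ∈ A - G := by
  rw [← neg_sub A G, Set.mem_neg]

theorem phi_le_coe {Ω : Type*} {G A : Set (Ω → ℝ)} {X : Ω → ℝ} {m : ℝ} (h : (fun ω => m - X ω) ∈ A - G) : phi G A X ≤ m :=
  sInf_le ⟨m, h, rfl⟩

theorem phi_le_zero_of_mem {Ω : Type*} {G A : Set (Ω → ℝ)} {X : Ω → ℝ} (hX : X ∈ G - A) : phi G A X ≤ 0 := by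
  have := phi_le_coe (G := G) (A := A) (X := X) (m := 0) (by
    convert mem_sub_comm_iff_neg_mem.1 hX using 1
    funext ω
    simp)
  simpa using this

section Superhedging

variable {Ω : Type*} [MeasurableSpace Ω] {Z : Ω → ℝ} {G A : Set (Ω → ℝ)}

theorem measurable_of_mem_sub (hGB : G ⊆ B Ω) (hAB : A ⊆ B Ω) {X : Ω → ℝ} (hX : X ∈ A - G) :
    Measurable X := by
  obtain ⟨a, ha, g, hg, rfl⟩ := Set.mem_sub.1 hX
  exact (show Measurable a from hAB ha).sub (show Measurable g from hGB hg)

/-- The surplus `Y - X` lies in `B⁺` and is absorbed into the `A` part. -/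
theorem mem_sub_of_le (hGB : G ⊆ B Ω) (hAB : A ⊆ B Ω) (hAadd : A + BPlus Ω ⊆ A)
    {X Y : Ω → ℝ} (hX : X ∈ A - G) (hY : Measurable Y) (hXY : ∀ ω, X ω ≤ Y ω) : Y ∈ A - G := by
  have hXm := measurable_of_mem_sub hGB hAB hX
  obtain ⟨a, ha, g, hg, rfl⟩ := Set.mem_sub.1 hX
  refine Set.mem_sub.2 ⟨a + (Y - (a - g)), hAadd (Set.add_mem_add ha ⟨hY.sub hXm, fun ω => ?_⟩),
    g, hg, by abel⟩
  exact sub_nonneg.2 (hXY ω)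

theorem zero_mem_sub (hG0 : (0 : Ω → ℝ) ∈ G) (hBA : BPlus Ω ⊆ A) : (0 : Ω → ℝ) ∈ A - G :=
  Set.mem_sub.2 ⟨0, hBA ⟨measurable_const, fun _ => le_rfl⟩, 0, hG0, sub_zero 0⟩

/-- `A - G` is a convex set of functions that contains `0` and every measurable function above one
of its elements. -/
structure IsHedgeable (G A : Set (Ω → ℝ)) : Prop where
  convex : Convex ℝ (A - G)
  mono : ∀ {X Y : Ω → ℝ}, X ∈ A - G → Measurable Y → (∀ ω, X ω ≤ Y ω) → Y ∈ A - G
  zero_mem : (0 : Ω → ℝ) ∈ A - G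

namespace IsHedgeable

/-- The infimum need not be attained, but the admissible `m` form an up-set, so every level strictly
above it is admissible. -/
theorem mem_of_phi_lt (h : IsHedgeable G A) {X : Ω → ℝ} (hX : Measurable X) {m : ℝ} (hm : phi G A X < m) :
    (fun ω => m - X ω) ∈ A - G := by
  obtain ⟨_, ⟨m', hm', rfl⟩, hlt⟩ := sInf_lt_iff.1 hm
  have hlt : m' < m := EReal.coe_lt_coe_iff.1 hlt
  exact h.mono hm' (hX.const_sub m) fun ω => by linarith

theorem phi_mono (h : IsHedgeable G A) {X Y : Ω → ℝ} (hX : Measurable X) (hXY : ∀ ω, X ω ≤ Y ω) :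
    phi G A X ≤ phi G A Y := by
  refine le_sInf ?_
  rintro _ ⟨m, hm, rfl⟩
  exact phi_le_coe (h.mono hm (hX.const_sub m) fun ω => by linarith [hXY ω])

/-- Real upper bounds `x`, `y` replace the values of `φ`, which avoids sums such as `∞ - ∞` before
finiteness is known. -/
theorem phi_convex_le (h : IsHedgeable G A) {X Y : Ω → ℝ} (hX : Measurable X) (hY : Measurable Y) {x y a b : ℝ}
    (hx : phi G A X ≤ x) (hy : phi G A Y ≤ y) (ha : 0 ≤ a) (hb : 0 ≤ b) (hab : a + b = 1) :
    phi G A (a • X + b • Y) ≤ (a * x + b * y : ℝ) := by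
  refine EReal.le_of_forall_lt_iff_le.1 fun m hm => ?_
  have hm : a * x + b * y < m := EReal.coe_lt_coe_iff.1 hm
  set ε := m - (a * x + b * y) with hε
  have hε0 : 0 < ε := sub_pos.2 hm
  have h1 := h.mem_of_phi_lt hX (m := x + ε)
    (hx.trans_lt (EReal.coe_lt_coe_iff.2 (by linarith)))
  have h2 := h.mem_of_phi_lt hY (m := y + ε)
    (hy.trans_lt (EReal.coe_lt_coe_iff.2 (by linarith)))
  refine phi_le_coe ?_
  convert h.convex h1 h2 ha hb hab using 1
  funext ω
  simp only [Pi.add_apply, Pi.smul_apply, smul_eq_mul]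
  have : m = a * x + b * y + (a + b) * ε := by rw [hab, hε]; ring
  rw [this]
  ring

theorem phi_add_const_le (h : IsHedgeable G A) {X : Ω → ℝ} (hX : Measurable X) {x : ℝ} (hx : phi G A X ≤ x) (c : ℝ) :
    phi G A (X + fun _ => c) ≤ (x + c : ℝ) := by
  refine EReal.le_of_forall_lt_iff_le.1 fun m hm => ?_
  have hm : x + c < m := EReal.coe_lt_coe_iff.1 hm
  have h1 := h.mem_of_phi_lt hX (m := m - c)
    (hx.trans_lt (EReal.coe_lt_coe_iff.2 (by linarith)))
  refine phi_le_coe ?_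
  convert h1 using 1
  funext ω
  simp only [Pi.add_apply]
  ring

theorem phi_zero_le (h : IsHedgeable G A) : phi G A 0 ≤ 0 := by
  have := phi_le_coe (G := G) (A := A) (X := 0) (m := 0) (by
    convert h.zero_mem using 1
    funext ω
    simp)
  simpa using this

/-- A negative level `m` admissible for `φ(0)` is the same as a constant gain `-m > 0` in `G - A`;
by monotonicity any gain `X ≥ ε` reduces to the constant `ε`. -/
theorem noUniformArbitrage_iff (h : IsHedgeable G A) :
    NoUniformArbitrage G A ↔ phi G A 0 = 0 := by
  constructor
  · intro hna
    refine le_antisymm h.phi_zero_le (le_sInf ?_)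
    rintro _ ⟨m, hm, rfl⟩
    by_contra hlt
    have hlt : m < 0 := by
      rw [not_le] at hlt
      exact EReal.coe_lt_coe_iff.1 hlt
    refine hna ⟨fun _ => -m, mem_sub_comm_iff_neg_mem.2 ?_, -m, by linarith, fun _ => le_rfl⟩
    have e : (-fun _ => -m) = fun ω => m - (0 : Ω → ℝ) ω := by
      funext ω
      simp
    rw [e]
    exact hm
  · rintro h0 ⟨X, hX, ε, hε, hXε⟩
    have hX' := mem_sub_comm_iff_neg_mem.1 hX
    have h1 : (fun ω => -ε - (0 : Ω → ℝ) ω) ∈ A - G := by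
      refine h.mono hX' (by fun_prop) fun ω => ?_
      simpa using hXε ω
    have h2 := phi_le_coe h1
    rw [h0] at h2
    have : (0 : ℝ) ≤ -ε := by exact_mod_cast h2
    linarith

/-- For `n ≥ c`, `X ≤ cZ ≤ nz + n(Z - z)⁺`, and the call condition superhedges the last term at cost
`1/n`. -/
theorem exists_phi_le (h : IsHedgeable G A) (hZ : ∀ ω, 1 ≤ Z ω)
    (hcall : CallCondition Z G A) {X : Ω → ℝ} (hX : X ∈ BZ Z) : ∃ m : ℝ, phi G A X ≤ m := by
  obtain ⟨hXm, c, hc, hXc⟩ := (mem_BZ_iff hZ).1 hX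
  obtain ⟨n, hn⟩ := exists_nat_ge (max c 1)
  have hn1 : (1 : ℝ) ≤ n := (le_max_right _ _).trans hn
  have hnc : c ≤ n := (le_max_left _ _).trans hn
  obtain ⟨z, hz, hmem⟩ := hcall n (by exact_mod_cast one_pos.trans_le hn1)
  refine ⟨1 / n + n * z, phi_le_coe (h.mono (mem_sub_comm_iff_neg_mem.1 hmem)
    (hXm.const_sub _) fun ω => ?_)⟩
  have h1 : Z ω - z ≤ max (Z ω - z) 0 := le_max_left _ _
  have h2 : X ω ≤ c * Z ω := (le_abs_self _).trans (hXc ω)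
  have h3 : c * Z ω ≤ n * Z ω := by
    have := hZ ω
    gcongr
  have h4 : (n : ℝ) * (Z ω - z) ≤ n * max (Z ω - z) 0 := by gcongr
  simp only [Pi.neg_apply]
  linarith

/-- The lower bound comes from convexity at the midpoint: `0 = φ(X/2 - X/2) ≤ φ(X)/2 + φ(-X)/2`,
with `φ(-X)` bounded above. -/
theorem exists_phi_eq (h : IsHedgeable G A) (hZ : ∀ ω, 1 ≤ Z ω)
    (hcall : CallCondition Z G A) (h0 : phi G A 0 = 0) {X : Ω → ℝ} (hX : X ∈ BZ Z) :
    ∃ r : ℝ, phi G A X = r := by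
  obtain ⟨m, hm⟩ := h.exists_phi_le hZ hcall hX
  obtain ⟨m', hm'⟩ := h.exists_phi_le hZ hcall ((weightedMeasurable Z hZ).neg_mem hX)
  have hlow : ((-m' : ℝ) : EReal) ≤ phi G A X := by
    refine EReal.le_of_forall_lt_iff_le.1 fun x hx => ?_
    have h1 := h.phi_convex_le (show Measurable X from hX.1) (show Measurable (-X) from hX.1.neg)
      hx.le hm' (by norm_num : (0 : ℝ) ≤ 1 / 2) (by norm_num : (0 : ℝ) ≤ 1 / 2) (by norm_num)
    rw [smul_neg, add_neg_cancel, h0] at h1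
    have h2 : (0 : ℝ) ≤ 1 / 2 * x + 1 / 2 * m' := by exact_mod_cast h1
    exact EReal.coe_le_coe_iff.2 (by linarith)
  refine ⟨(phi G A X).toReal, (EReal.coe_toReal ?_ ?_).symm⟩
  · exact (hm.trans_lt (EReal.coe_lt_top m)).ne
  · exact ((EReal.bot_lt_coe (-m')).trans_le hlow).ne'

/-- For each `X ∈ B_Z` the convex function `W ↦ φ(X + W)` on `C_Z` has a subgradient at `0` which is
given by a measure in `𝒫_Z`. -/
theorem exists_measure_integral_le (h : IsHedgeable G A) [TopologicalSpace Ω] [BorelSpace Ω] [T2Space Ω]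
    (hZ : ∀ ω, 1 ≤ Z ω)
    (hZc : Continuous Z) (hcomp : ∀ z : ℝ, 0 ≤ z → IsCompact {ω : Ω | Z ω ≤ z})
    (hcall : CallCondition Z G A) (h0 : phi G A 0 = 0) {X : Ω → ℝ} (hX : X ∈ BZ Z) :
    ∃ P ∈ PZ Z, ∀ W ∈ CZ Z,
      ∫ ω, W ω ∂P ≤ (phi G A (X + W)).toReal - (phi G A X).toReal := by
  have hXW : ∀ W : weightedContinuous Z hZ, X + W.1 ∈ BZ Z := fun W =>
    (weightedMeasurable Z hZ).add_mem hX W.2.1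
  have hm : ∀ Y ∈ BZ Z, Measurable Y := fun Y hY => hY.1
  have hreal : ∀ Y ∈ BZ Z, phi G A Y = ((phi G A Y).toReal : EReal) := by
    intro Y hY
    obtain ⟨r, hr⟩ := h.exists_phi_eq hZ hcall h0 hY
    rw [hr, EReal.toReal_coe]
  set f : weightedContinuous Z hZ → ℝ := fun W => (phi G A (X + W.1)).toReal with hf
  have hfle : ∀ W r, phi G A (X + W.1) ≤ (r : ℝ) → f W ≤ r := by
    intro W r hr
    rw [hreal _ (hXW W)] at hr
    exact EReal.coe_le_coe_iff.1 hr
  have hf0 : f 0 = (phi G A X).toReal := by simp [hf]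
  have hconv : ConvexOn ℝ univ f := by
    refine ⟨convex_univ, fun V _ W _ a b ha hb hab => hfle _ _ ?_⟩
    have h1 := h.phi_convex_le (hm _ (hXW V)) (hm _ (hXW W)) (hreal _ (hXW V)).le
      (hreal _ (hXW W)).le ha hb hab
    refine le_of_eq_of_le (congrArg _ ?_) h1
    have : X = a • X + b • X := by rw [← add_smul, hab, one_smul]
    simp only [Submodule.coe_add, Submodule.coe_smul]
    nth_rewrite 1 [this]
    rw [smul_add, smul_add]
    abel
  obtain ⟨l, hl⟩ := hconv.exists_subgradient_zero
  rw [hf0] at hl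
  have hpos : ∀ W : weightedContinuous Z hZ, (∀ ω, 0 ≤ W.1 ω) → 0 ≤ l W := by
    intro W hW
    have h1 : f (-W) ≤ (phi G A X).toReal := by
      refine hfle _ _ ?_
      rw [← hreal X hX]
      refine h.phi_mono (hm _ (hXW (-W))) fun ω => ?_
      have := hW ω
      simp only [Submodule.coe_neg, Pi.add_apply, Pi.neg_apply]
      linarith
    have h2 := hl (-W)
    rw [map_neg] at h2
    linarith
  have hconst : ∀ c : ℝ, l ⟨fun _ => c, const_mem_CZ hZ c⟩ ≤ c := by
    intro c
    have h1 := hfle ⟨fun _ => c, const_mem_CZ hZ c⟩ _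
      (h.phi_add_const_le (hm _ hX) (hreal X hX).le c)
    have h2 := hl ⟨fun _ => c, const_mem_CZ hZ c⟩
    linarith
  have hone : l ⟨fun _ => 1, const_mem_CZ hZ 1⟩ = 1 := by
    refine le_antisymm (hconst 1) ?_
    have h1 := hconst (-1)
    have h2 : (⟨fun _ => -1, const_mem_CZ hZ (-1)⟩ : weightedContinuous Z hZ)
        = -⟨fun _ => 1, const_mem_CZ hZ 1⟩ := rfl
    rw [h2, map_neg] at h1
    linarith
  have h2X : (2 : ℝ) • X ∈ BZ Z := (weightedMeasurable Z hZ).smul_mem 2 hX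
  -- With `H = (Z - z)⁺`, the subgradient inequality and convexity give `n * l H ≤ φ(X + nH) - φ(X)
  -- ≤ φ(2X)/2 + φ(2nH)/2 - φ(X)`. Choosing `z` for `2n` yields `φ(2nH) ≤ 1`, so the right side is
  -- at most `C`, which does not depend on `n`.
  have htight : ∀ ε : ℝ, 0 < ε → ∃ (z : ℝ) (hz : 0 ≤ z),
      l ⟨fun ω => max (Z ω - z) 0, call_mem_CZ hZ hZc hz⟩ ≤ ε := by
    intro ε hε
    set C : ℝ := 1 / 2 * (phi G A ((2 : ℝ) • X)).toReal + 1 / 2 - (phi G A X).toReal with hC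
    obtain ⟨n, hn⟩ := exists_nat_ge (max (C / ε) 1)
    have hn1 : (1 : ℝ) ≤ n := (le_max_right _ _).trans hn
    have hnC : C ≤ n * ε := (div_le_iff₀ hε).1 ((le_max_left _ _).trans hn)
    have hnpos : 0 < n := by exact_mod_cast one_pos.trans_le hn1
    obtain ⟨z, hz, hmem⟩ := hcall (2 * n) (by positivity)
    refine ⟨z, hz, ?_⟩
    set H : weightedContinuous Z hZ := ⟨fun ω => max (Z ω - z) 0, call_mem_CZ hZ hZc hz⟩ with hH
    have hphi : phi G A ((2 * n : ℝ) • H.1) ≤ (1 : ℝ) := by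
      refine phi_le_coe (h.mono (mem_sub_comm_iff_neg_mem.1 hmem)
        ((hm _ H.2.1).const_smul (2 * n : ℝ) |>.const_sub 1) fun ω => ?_)
      simp only [Pi.neg_apply, Pi.smul_apply, smul_eq_mul, hH]
      push_cast
      have : (1 : ℝ) / (2 * n) ≤ 1 := by
        rw [div_le_one (by positivity)]
        linarith
      linarith
    have h1 := h.phi_convex_le (hm _ h2X) ((hm _ H.2.1).const_smul (2 * n : ℝ))
      (hreal _ h2X).le hphi (by norm_num : (0 : ℝ) ≤ 1 / 2) (by norm_num : (0 : ℝ) ≤ 1 / 2)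
      (by norm_num)
    have e : (1 / 2 : ℝ) • (2 : ℝ) • X + (1 / 2 : ℝ) • (2 * n : ℝ) • H.1
        = X + ((n : ℝ) • H).1 := by
      rw [smul_smul, smul_smul]
      have : (1 / 2 : ℝ) * (2 * n) = n := by ring
      rw [this]
      norm_num
    rw [e] at h1
    have h2 := hfle _ _ h1
    have h3 := hl ((n : ℝ) • H)
    rw [map_smul, smul_eq_mul] at h3
    have h4 : (n : ℝ) * l H ≤ n * ε := by linarith
    exact le_of_mul_le_mul_left h4 (by positivity)
  obtain ⟨P, hP, hint⟩ := exists_measure_integral_eq hZ hZc hcomp l hpos hone htight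
  exact ⟨P, hP, fun W hW => (hint ⟨W, hW⟩).trans_le (hl ⟨W, hW⟩)⟩

end IsHedgeable

end Superhedging

/-- The Fenchel–Young inequality; finiteness of `φ(Y)` permits the cancellation in `EReal`. -/
theorem integral_sub_phiStar_le {Ω : Type*} [TopologicalSpace Ω] [MeasurableSpace Ω] {Z : Ω → ℝ}
    {G A : Set (Ω → ℝ)} {Y : Ω → ℝ} (hY : Y ∈ CZ Z) {r : ℝ} (hr : phi G A Y = r) (P : Measure Ω) :
    ((∫ ω, Y ω ∂P : ℝ) : EReal) - phiStar Z G A P ≤ phi G A Y := by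
  have h1 : ((∫ ω, Y ω ∂P : ℝ) : EReal) - phi G A Y ≤ phiStar Z G A P :=
    le_iSup₂ (f := fun X (_ : X ∈ CZ Z) => ((∫ ω, X ω ∂P : ℝ) : EReal) - phi G A X) Y hY
  refine (EReal.sub_le_sub le_rfl h1).trans (le_of_eq ?_)
  rw [hr, ← EReal.coe_sub, ← EReal.coe_sub, sub_sub_cancel]

/-! ### Dual formulas and pricing measures. -/

section Metric

variable {Ω : Type*} [MetricSpace Ω] [MeasurableSpace Ω] [BorelSpace Ω] {Z : Ω → ℝ}
  {G A : Set (Ω → ℝ)}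

/-- The expectation of an element of `U_Z` is the infimum of those of the elements of `C_Z`
above it. -/
theorem exists_CZ_integral_le (hZ : ∀ ω, 1 ≤ Z ω) (hZc : Continuous Z) {X : Ω → ℝ} (hX : X ∈ UZ Z)
    {P : Measure Ω} (hP : Integrable Z P) {ε : ℝ} (hε : 0 < ε) :
    ∃ Y ∈ CZ Z, (∀ ω, X ω ≤ Y ω) ∧ ∫ ω, Y ω ∂P < ∫ ω, X ω ∂P + ε := by
  have hpos : ∀ ω, 0 < Z ω := fun ω => one_pos.trans_le (hZ ω)
  obtain ⟨c, hc⟩ := hX.1.2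
  have husc : UpperSemicontinuous fun ω => X ω / Z ω := by
    -- `X / Z < a` is equivalent to `X - aZ < 0`, and `X - aZ` is upper semicontinuous whatever the
    -- sign of `a`.
    intro ω a ha
    have h1 : UpperSemicontinuous fun ω => X ω + -(a * Z ω) :=
      hX.2.add (by fun_prop : Continuous fun ω => -(a * Z ω)).upperSemicontinuous
    have h2 : X ω + -(a * Z ω) < 0 := by
      have := (div_lt_iff₀ (hpos ω)).1 ha
      linarith
    filter_upwards [h1 ω 0 h2] with x hx
    rw [div_lt_iff₀ (hpos x)]
    linarith
  obtain ⟨Y, hYc, hYge, hYb, hYt⟩ := husc.exists_continuous_tendsto hc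
  have habs : ∀ n ω, |Z ω * Y n ω| ≤ c * Z ω := by
    intro n ω
    rw [abs_mul, abs_of_pos (hpos ω), mul_comm]
    exact mul_le_mul_of_nonneg_right (hYb n ω) (hpos ω).le
  have ht : Tendsto (fun n => ∫ ω, Z ω * Y n ω ∂P) atTop (𝓝 (∫ ω, X ω ∂P)) := by
    refine tendsto_integral_of_dominated_convergence (fun ω => c * Z ω)
      (fun n => (hZc.mul (hYc n)).measurable.aestronglyMeasurable) (hP.const_mul c)
      (fun n => ae_of_all _ (habs n)) (ae_of_all _ fun ω => ?_)
    have h1 := (hYt ω).const_mul (Z ω)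
    rwa [mul_div_cancel₀ _ (hpos ω).ne'] at h1
  obtain ⟨n, hn⟩ := (ht.eventually (gt_mem_nhds (lt_add_of_pos_right _ hε))).exists
  refine ⟨_, mem_CZ_of_abs_le hZ (hZc.mul (hYc n)) (habs n), fun ω => ?_, hn⟩
  exact (div_le_iff₀' (hpos ω)).1 (hYge n ω)

/-- The measure attaining `φ(0)` in the dual formula is a pricing measure. -/
theorem hasPricingMeasure_of_hasDualFormula (hZ : ∀ ω, 1 ≤ Z ω) {D : Set (Ω → ℝ)}
    (hD : CZ Z ⊆ D) (hdual : HasDualFormula Z G A D) : HasPricingMeasure Z G A D := by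
  obtain ⟨-, h0, hmax⟩ := hdual
  obtain ⟨P, hP, hPeq⟩ := (hmax 0 (hD (const_mem_CZ hZ 0))).1
  -- Attainment at `0` forces `φ*(P) = 0`; the dual formula then gives `E^P X ≤ φ(X) ≤ 0` on `G -
  -- A`.
  have hstar : phiStar Z G A P = 0 := by
    have h1 : (0 : EReal) - phiStar Z G A P = 0 := by
      simpa [h0] using hPeq
    rwa [zero_sub, EReal.neg_eq_zero_iff] at h1
  refine ⟨P, hP, fun X hX => ?_⟩
  have h1 := (hmax X hX.1).2 ⟨P, hP, rfl⟩
  simp only [hstar, sub_zero] at h1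
  exact_mod_cast h1.trans (phi_le_zero_of_mem hX.2)

namespace IsHedgeable

/-- To bound `φ*(P)`, the subgradient inequality should be tested in direction `V - X`, which need
not be continuous. A continuous `Y ≥ X` with nearly the same expectation replaces `X`, and `X + (V -
Y) ≤ V` gives `E V - E Y ≤ φ(V) - φ(X)`. -/
theorem exists_phi_le_integral_sub_phiStar (h : IsHedgeable G A) (hZ : ∀ ω, 1 ≤ Z ω)
    (hZc : Continuous Z) (hcomp : ∀ z : ℝ, 0 ≤ z → IsCompact {ω : Ω | Z ω ≤ z})
    (hcall : CallCondition Z G A) (h0 : phi G A 0 = 0) {X : Ω → ℝ} (hX : X ∈ UZ Z) :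
    ∃ P ∈ PZ Z, phi G A X ≤ ((∫ ω, X ω ∂P : ℝ) : EReal) - phiStar Z G A P := by
  have hreal : ∀ Y ∈ BZ Z, phi G A Y = ((phi G A Y).toReal : EReal) := by
    intro Y hY
    obtain ⟨r, hr⟩ := h.exists_phi_eq hZ hcall h0 hY
    rw [hr, EReal.toReal_coe]
  obtain ⟨P, hP, hle⟩ := h.exists_measure_integral_le hZ hZc hcomp hcall h0 hX.1
  refine ⟨P, hP, ?_⟩
  have hint : ∀ Y ∈ BZ Z, Integrable Y P := fun Y hY => integrable_of_mem_BZ hZ hY hP.2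
  have hstar : phiStar Z G A P ≤ (∫ ω, X ω ∂P - (phi G A X).toReal : ℝ) := by
    refine iSup₂_le fun V hV => ?_
    rw [hreal V hV.1, ← EReal.coe_sub, EReal.coe_le_coe_iff]
    refine le_of_forall_pos_le_add fun ε hε => ?_
    obtain ⟨Y, hY, hXY, hYint⟩ := exists_CZ_integral_le hZ hZc hX hP.2 hε
    have hW : V - Y ∈ CZ Z := (weightedContinuous Z hZ).sub_mem hV hY
    have h1 := hle (V - Y) hW
    have h2 : ∫ ω, (V - Y) ω ∂P = ∫ ω, V ω ∂P - ∫ ω, Y ω ∂P :=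
      integral_sub (hint V hV.1) (hint Y hY.1)
    have hXW : X + (V - Y) ∈ BZ Z := (weightedMeasurable Z hZ).add_mem hX.1 hW.1
    have h3 : phi G A (X + (V - Y)) ≤ phi G A V := h.phi_mono hXW.1 fun ω => by
      have := hXY ω
      simp only [Pi.add_apply, Pi.sub_apply]
      linarith
    rw [hreal _ hXW, hreal V hV.1, EReal.coe_le_coe_iff] at h3
    linarith
  calc phi G A X = ((∫ ω, X ω ∂P : ℝ) : EReal) - (∫ ω, X ω ∂P - (phi G A X).toReal : ℝ) := by
        rw [← EReal.coe_sub, sub_sub_cancel]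
        exact hreal X hX.1
    _ ≤ _ := EReal.sub_le_sub le_rfl hstar

theorem hasDualFormula_of_forall_le (h : IsHedgeable G A) (hZ : ∀ ω, 1 ≤ Z ω)
    (hZc : Continuous Z) (hcomp : ∀ z : ℝ, 0 ≤ z → IsCompact {ω : Ω | Z ω ≤ z})
    (hcall : CallCondition Z G A) (h0 : phi G A 0 = 0) {D : Set (Ω → ℝ)} (hD : D ⊆ UZ Z)
    (hle : ∀ X ∈ D, ∀ P ∈ PZ Z, ((∫ ω, X ω ∂P : ℝ) : EReal) - phiStar Z G A P ≤ phi G A X) :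
    HasDualFormula Z G A D := by
  refine ⟨fun X hX => h.exists_phi_eq hZ hcall h0 hX, h0, fun X hX => ⟨?_, ?_⟩⟩
  · obtain ⟨P, hP, hPX⟩ := h.exists_phi_le_integral_sub_phiStar hZ hZc hcomp hcall h0 (hD hX)
    exact ⟨P, hP, le_antisymm (hle X hX P hP) hPX⟩
  · rintro _ ⟨P, hP, rfl⟩
    exact hle X hX P hP

theorem hasDualFormula_CZ (h : IsHedgeable G A) (hZ : ∀ ω, 1 ≤ Z ω)
    (hZc : Continuous Z) (hcomp : ∀ z : ℝ, 0 ≤ z → IsCompact {ω : Ω | Z ω ≤ z})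
    (hcall : CallCondition Z G A) (h0 : phi G A 0 = 0) : HasDualFormula Z G A (CZ Z) := by
  refine h.hasDualFormula_of_forall_le hZ hZc hcomp hcall h0 CZ_subset_UZ fun X hX P _ => ?_
  obtain ⟨r, hr⟩ := h.exists_phi_eq hZ hcall h0 hX.1
  exact integral_sub_phiStar_le hX hr P

/-- By (2) the upper bound for `X` follows from Fenchel–Young for each `Y ∈ C_Z` above it. -/
theorem hasDualFormula_UZ (h : IsHedgeable G A) (hZ : ∀ ω, 1 ≤ Z ω)
    (hZc : Continuous Z) (hcomp : ∀ z : ℝ, 0 ≤ z → IsCompact {ω : Ω | Z ω ≤ z})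
    (hcall : CallCondition Z G A) (h0 : phi G A 0 = 0) (husc : UscCondition Z G A) :
    HasDualFormula Z G A (UZ Z) := by
  refine h.hasDualFormula_of_forall_le hZ hZc hcomp hcall h0 subset_rfl fun X hX P hP => ?_
  rw [husc X hX]
  refine le_sInf ?_
  rintro _ ⟨Y, ⟨hY, hXY⟩, rfl⟩
  obtain ⟨r, hr⟩ := h.exists_phi_eq hZ hcall h0 hY.1
  refine le_trans (EReal.sub_le_sub ?_ le_rfl) (integral_sub_phiStar_le hY hr P)
  exact EReal.coe_le_coe_iff.2 (integral_mono (integrable_of_mem_BZ hZ hX.1 hP.2)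
    (integrable_of_mem_BZ hZ hY.1 hP.2) hXY)

/-! ### Pricing measures exclude arbitrage. -/

theorem noUniformArbitrage_of_hasPricingMeasure (h : IsHedgeable G A) (hZ : ∀ ω, 1 ≤ Z ω)
    (hprice : HasPricingMeasure Z G A (CZ Z)) : NoUniformArbitrage G A := by
  obtain ⟨P, hP, hPle⟩ := hprice
  have := hP.1
  rintro ⟨X, hX, ε, hε, hXε⟩
  have h1 : (fun _ => ε) ∈ G - A := by
    refine mem_sub_comm_iff_neg_mem.2 (h.mono (mem_sub_comm_iff_neg_mem.1 hX)
      measurable_const.neg fun ω => neg_le_neg (hXε ω))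
  have h2 := hPle _ ⟨const_mem_CZ hZ ε, h1⟩
  rw [integral_const, probReal_univ, one_smul] at h2
  linarith

/-- A strictly positive `X ∈ G - A` need not lie in `U_Z`. It dominates `ε` times the indicator of a
closed set of positive measure, which does, and which stays in `G - A`. -/
theorem noPointwiseArbitrage_of_hasPricingMeasure (h : IsHedgeable G A)
    (hmeas : ∀ X ∈ A - G, Measurable X) (hZ : ∀ ω, 1 ≤ Z ω)
    (hprice : HasPricingMeasure Z G A (UZ Z)) : NoPointwiseArbitrage G A := by
  obtain ⟨P, hP, hPle⟩ := hprice
  have := hP.1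
  rintro ⟨X, hX, hXpos⟩
  have hXm : Measurable X := by
    have := (hmeas _ (mem_sub_comm_iff_neg_mem.1 hX)).neg
    rwa [neg_neg] at this
  obtain ⟨n, hn⟩ : ∃ n : ℕ, 0 < P {ω | 1 / ((n : ℝ) + 1) ≤ X ω} := by
    by_contra! hcon
    have hzero : P (⋃ n : ℕ, {ω | 1 / ((n : ℝ) + 1) ≤ X ω}) = 0 :=
      measure_iUnion_null fun n => le_antisymm (hcon n) zero_le
    have huniv : (⋃ n : ℕ, {ω | 1 / ((n : ℝ) + 1) ≤ X ω}) = univ := by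
      refine eq_univ_of_forall fun ω => mem_iUnion.2 ?_
      obtain ⟨n, hn⟩ := exists_nat_one_div_lt (hXpos ω)
      exact ⟨n, hn.le⟩
    rw [huniv, measure_univ] at hzero
    exact one_ne_zero hzero
  set ε : ℝ := 1 / ((n : ℝ) + 1) with hε
  have hε0 : 0 < ε := by positivity
  -- Finite Borel measures on a metric space are inner regular for closed sets.
  obtain ⟨F, hFsub, hF, hFpos⟩ :=
    (measurableSet_le measurable_const hXm).exists_lt_isClosed_of_ne_top (measure_ne_top P _) hn
  set Y : Ω → ℝ := F.indicator fun _ => ε with hY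
  have hYm : Measurable Y := measurable_const.indicator hF.measurableSet
  have hYU : Y ∈ UZ Z := by
    refine ⟨(mem_BZ_iff hZ).2 ⟨hYm, ε, hε0.le, fun ω => ?_⟩,
      hF.upperSemicontinuous_indicator hε0.le⟩
    have h1 : 0 ≤ Y ω := indicator_nonneg (fun _ _ => hε0.le) ω
    have h2 : Y ω ≤ ε := indicator_le_self' (fun _ _ => hε0.le) ω
    rw [abs_of_nonneg h1]
    exact h2.trans (le_mul_of_one_le_right hε0.le (hZ ω))
  have hYX : ∀ ω, Y ω ≤ X ω := by
    intro ω
    by_cases hω : ω ∈ F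
    · rw [hY, indicator_of_mem hω]
      exact hFsub hω
    · rw [hY, indicator_of_notMem hω]
      exact (hXpos ω).le
  have hYmem : Y ∈ G - A := mem_sub_comm_iff_neg_mem.2
    (h.mono (mem_sub_comm_iff_neg_mem.1 hX) hYm.neg fun ω => neg_le_neg (hYX ω))
  have h1 := hPle Y ⟨hYU, hYmem⟩
  rw [hY, integral_indicator_const _ hF.measurableSet, smul_eq_mul] at h1
  have h2 : 0 < P.real F := ENNReal.toReal_pos hFpos.ne' (measure_ne_top P F)
  nlinarith [mul_pos h2 hε0]

end IsHedgeable

end Metric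

end RobustHedging

theorem theorem2p1 (T J : ℕ)
    (Ω : Set (RobustHedging.PathSpace T J)) (hΩne : Ω.Nonempty)
    (hΩ : Ω ⊆ RobustHedging.positivePaths T J)
    (Z : Ω → ℝ) (hZcont : Continuous Z) (hZone : ∀ ω, 1 ≤ Z ω)
    (hZcompact : ∀ z : ℝ, 0 ≤ z → IsCompact {ω : Ω | Z ω ≤ z})
    (G A : Set (Ω → ℝ))
    (hGB : G ⊆ RobustHedging.B Ω) (hG0 : (0 : Ω → ℝ) ∈ G)
    (hAB : A ⊆ RobustHedging.B Ω) (hBA : RobustHedging.BPlus Ω ⊆ A)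
    (hAadd : A + RobustHedging.BPlus Ω ⊆ A)
    (hconv : Convex ℝ (A - G))
    (hcall : RobustHedging.CallCondition Z G A) :
    List.TFAE [
      RobustHedging.NoUniformArbitrage G A,
      RobustHedging.HasPricingMeasure Z G A (RobustHedging.CZ Z),
      RobustHedging.HasDualFormula Z G A (RobustHedging.CZ Z)] ∧
    (RobustHedging.UscCondition Z G A →
      List.TFAE [
        RobustHedging.NoUniformArbitrage G A,
        RobustHedging.HasPricingMeasure Z G A (RobustHedging.CZ Z),
        RobustHedging.HasDualFormula Z G A (RobustHedging.CZ Z),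
        RobustHedging.NoPointwiseArbitrage G A,
        RobustHedging.HasPricingMeasure Z G A (RobustHedging.UZ Z),
        RobustHedging.HasDualFormula Z G A (RobustHedging.UZ Z)]) := by
  have hmeas : ∀ X ∈ A - G, Measurable X :=
    fun X hX => RobustHedging.measurable_of_mem_sub hGB hAB hX
  have h : RobustHedging.IsHedgeable G A :=
    ⟨hconv, RobustHedging.mem_sub_of_le hGB hAB hAadd, RobustHedging.zero_mem_sub hG0 hBA⟩
  have h13 : RobustHedging.NoUniformArbitrage G A →
      RobustHedging.HasDualFormula Z G A (RobustHedging.CZ Z) := fun hna =>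
    h.hasDualFormula_CZ hZone hZcont hZcompact hcall (h.noUniformArbitrage_iff.1 hna)
  have h32 : RobustHedging.HasDualFormula Z G A (RobustHedging.CZ Z) →
      RobustHedging.HasPricingMeasure Z G A (RobustHedging.CZ Z) :=
    RobustHedging.hasPricingMeasure_of_hasDualFormula hZone subset_rfl
  have h21 : RobustHedging.HasPricingMeasure Z G A (RobustHedging.CZ Z) →
      RobustHedging.NoUniformArbitrage G A := h.noUniformArbitrage_of_hasPricingMeasure hZone
  refine ⟨?_, fun husc => ?_⟩
  · tfae_have 1 → 3 := h13
    tfae_have 3 → 2 := h32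
    tfae_have 2 → 1 := h21
    tfae_finish
  · tfae_have 1 → 3 := h13
    tfae_have 3 → 2 := h32
    tfae_have 2 → 1 := h21
    -- The second cycle 1 → 6 → 5 → 4 → 1 is joined to the first at 1; (2) enters only in this
    -- implication.
    tfae_have 1 → 6 := fun hna => h.hasDualFormula_UZ hZone hZcont hZcompact hcall
      (h.noUniformArbitrage_iff.1 hna) husc
    tfae_have 6 → 5 :=
      RobustHedging.hasPricingMeasure_of_hasDualFormula hZone RobustHedging.CZ_subset_UZ
    tfae_have 5 → 4 := h.noPointwiseArbitrage_of_hasPricingMeasure hmeas hZone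
    tfae_have 4 → 1 := by
      rintro hna ⟨X, hX, ε, hε, hXε⟩
      exact hna ⟨X, hX, fun ω => hε.trans_le (hXε ω)⟩
    tfae_finish
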